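/- Let $n\ge 1$, let $e_1,\dots,e_n\in\mathbb{Z}[x_1,\dots,x_n]$ be the elementary symmetric polynomials, let $J=\langle e_1,\dots,e_n\rangle$, and let $R=\mathbb{Z}[x_1,\dots,x_n]/J$, graded by polynomial degree. (By Borel's presentation, $R$ is the integral cohomology ring $H^*(GL_n(\mathbb{C})/B)$ of the complete flag variety, with degree-$d$ part $R_d\cong H^{2d}(GL_n(\mathbb{C})/B;\mathbb{Z})$.) The nilpotence order of a nilpotent element $f$ is the smallest integer $k\ge 0$ such that $f^k=0$. Let $f\in R_1$ be nonzero. Then $f$ is nilpotent, its nilpotence order is at least $n$, and its nilpotence order is exactly $n$ if and only if there are $i\in\{1,\dots,n\}$ and $c\in\mathbb{Z}$ such that $f$ is the class modulo $J$ of $c\,x_i$. -/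

import Mathlib

namespace FlagCohomology

/-- The ideal `J = ⟨e_1, …, e_n⟩` of `ℤ[x_1, …, x_n]` generated by the elementary symmetric
polynomials of positive degree; the variable `x_{i+1}` is indexed by `i : Fin n`. -/
noncomputable def J (n : ℕ) : Ideal (MvPolynomial (Fin n) ℤ) :=
  Ideal.span {p | ∃ i : ℕ, 1 ≤ i ∧ i ≤ n ∧ p = MvPolynomial.esymm (Fin n) ℤ i}

/-- The ring `ℤ[x_1, …, x_n] / J`, the integral cohomology ring of the complete flag variety
`GL_n / B` in the Borel presentation. -/
abbrev CohomologyRing (n : ℕ) : Type :=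
  MvPolynomial (Fin n) ℤ ⧸ J n

/-- The class of a variable in `ℤ[x_1, …, x_n] / J`. -/
noncomputable def x {n : ℕ} (i : Fin n) : CohomologyRing n :=
  Ideal.Quotient.mk (J n) (MvPolynomial.X i)

/-- The graded piece of (polynomial) degree `d`, that is `H^{2d}(GL_n / B)`: the image of the
homogeneous polynomials of degree `d`. -/
noncomputable def degreePart (n d : ℕ) : Submodule ℤ (CohomologyRing n) :=
  (MvPolynomial.homogeneousSubmodule (Fin n) ℤ d).map (Ideal.Quotient.mkₐ ℤ (J n)).toLinearMap

end FlagCohomology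

/-! Let polynomials act as constant-coefficient differential operators. The Vandermonde polynomial
is killed by `J n` (`diffOp_vandermondePoly_of_mem_J`), so it detects nonzero powers. For `f = ∑ aᵢ
xᵢ`, let `N` count the pairs `i < j` with `aᵢ ≠ aⱼ`. The directional derivative along `a` sends each
factor `xⱼ - xᵢ` to the constant `aⱼ - aᵢ`, so its `N`-th iterate on the Vandermonde polynomial is
nonzero and `f ^ N ≠ 0` (`linearForm_pow_ne_zero`).

If `a` is constant off one index `i`, then `f` is a multiple of `xᵢ`, because `∑ xⱼ = 0`; here `N ≥
n - 1` while `xᵢ ^ n = 0`, so the order is `n`. Otherwise every entry differs from at least two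
others, so `N ≥ n` and the order exceeds `n`. -/

namespace FlagCohomology

open MvPolynomial Finset

/-! ### Polynomials as differential operators. -/

section DifferentialOperators

variable {σ R : Type*} [CommRing R]

theorem pderiv_comm (i j : σ) (p : MvPolynomial σ R) :
    pderiv i (pderiv j p) = pderiv j (pderiv i p) := by
  classical
  have h : ⁅(pderiv i : Derivation R (MvPolynomial σ R) (MvPolynomial σ R)), (pderiv j : Derivation R (MvPolynomial σ R) (MvPolynomial σ R))⁆ = 0 := by
    refine MvPolynomial.derivation_ext fun k => ?_
    simp only [Derivation.commutator_apply, pderiv_X, Derivation.coe_zero, Pi.zero_apply]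
    simp [Pi.single_apply, apply_ite]
  have := congrArg (fun D => D p) h
  simpa [Derivation.commutator_apply, sub_eq_zero] using this

/-- Polynomials act on polynomials as differential operators with constant coefficients. -/
theorem exists_diffOp (σ R : Type*) [CommRing R] :
    ∃ φ : MvPolynomial σ R →ₐ[R] Module.End R (MvPolynomial σ R),
      ∀ i p, φ (X i) p = pderiv i p := by
  let s : Set (Module.End R (MvPolynomial σ R)) :=
    Set.range fun i => (pderiv i : Derivation R (MvPolynomial σ R) (MvPolynomial σ R)).toLinearMap
  have hs : ∀ a ∈ s, ∀ b ∈ s, a * b = b * a := by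
    rintro _ ⟨i, rfl⟩ _ ⟨j, rfl⟩
    exact LinearMap.ext fun p => pderiv_comm i j p
  -- `aeval` needs a commutative target: the subalgebra generated by the commuting partials.
  have := Algebra.isMulCommutative_adjoin R hs
  open scoped IsMulCommutative in
  exact ⟨(Algebra.adjoin R s).val.comp
    (aeval fun i => ⟨_, Algebra.subset_adjoin (Set.mem_range_self i)⟩), fun i p => by simp⟩

/-- The action of polynomials by differential operators: `X i` acts as `∂/∂xᵢ`. -/
noncomputable def diffOp (σ R : Type*) [CommRing R] :
    MvPolynomial σ R →ₐ[R] Module.End R (MvPolynomial σ R) :=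
  (exists_diffOp σ R).choose

@[simp]
theorem diffOp_X (i : σ) (p : MvPolynomial σ R) : diffOp σ R (X i) p = pderiv i p :=
  (exists_diffOp σ R).choose_spec i p

theorem rename_diffOp (e : Equiv.Perm σ) (p h : MvPolynomial σ R) :
    rename e (diffOp σ R p h) = diffOp σ R (rename e p) (rename e h) := by
  induction p using MvPolynomial.induction_on generalizing h with
  | C r => simp [← algebraMap_eq, Module.algebraMap_end_apply]
  | add p q hp hq => simp [hp, hq]
  | mul_X p i hp => simp [hp, pderiv_rename e.injective]

theorem degree_of_coeff_diffOp_prod_X (t : Finset σ) {h : MvPolynomial σ R} {N : ℕ}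
    (hh : h.IsHomogeneous N) {d : σ →₀ ℕ} (hd : coeff d (diffOp σ R (∏ i ∈ t, X i) h) ≠ 0) :
    d.degree + #t = N := by
  classical
  induction t using Finset.induction_on generalizing d with
  | empty =>
    simp only [prod_empty, map_one, Module.End.one_apply] at hd
    by_contra hne
    exact hd (hh.coeff_eq_zero (by simpa using hne))
  | insert i t hi ih =>
    rw [prod_insert hi, map_mul, Module.End.mul_apply, diffOp_X, coeff_pderiv] at hd
    have := ih (left_ne_zero_of_mul hd)
    rw [card_insert_of_notMem hi, ← this, map_add, Finsupp.degree_single]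
    ring

theorem degree_of_coeff_diffOp_esymm [Fintype σ] (k : ℕ) {h : MvPolynomial σ R} {N : ℕ}
    (hh : h.IsHomogeneous N) {d : σ →₀ ℕ} (hd : coeff d (diffOp σ R (esymm σ R k) h) ≠ 0) :
    d.degree + k = N := by
  rw [esymm, map_sum, LinearMap.sum_apply, coeff_sum] at hd
  obtain ⟨t, ht, hne⟩ := exists_ne_zero_of_sum_ne_zero hd
  rw [← (mem_powersetCard.1 ht).2]
  exact degree_of_coeff_diffOp_prod_X t hh hne

/-- An alternating polynomial is supported on exponents with pairwise distinct entries. -/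
theorem injective_of_coeff_ne_zero [IsAddTorsionFree R] [Fintype σ] [DecidableEq σ]
    {h : MvPolynomial σ R}
    (hh : ∀ e : Equiv.Perm σ, rename e h = (Equiv.Perm.sign e : ℤ) • h) {d : σ →₀ ℕ}
    (hd : coeff d h ≠ 0) : Function.Injective d := by
  intro i j hij
  by_contra hne
  have h1 := coeff_rename_mapDomain (Equiv.swap i j) (Equiv.swap i j).injective h d
  have h2 : d.mapDomain (Equiv.swap i j) = d := by
    ext k
    rw [← Finsupp.equivMapDomain_eq_mapDomain, Finsupp.equivMapDomain_apply, Equiv.symm_swap]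
    by_cases hki : k = i
    · simp [hki, hij]
    by_cases hkj : k = j
    · simp [hkj, hij]
    rw [Equiv.swap_apply_of_ne_of_ne hki hkj]
  rw [h2, hh, Equiv.Perm.sign_swap hne] at h1
  simp only [Units.val_neg, Units.val_one, neg_smul, one_smul, coeff_neg] at h1
  exact hd (self_eq_neg.1 h1.symm)

end DifferentialOperators

/-! ### The Vandermonde polynomial is annihilated by `J n`. -/

section Vandermonde

theorem sum_range_le_sum_of_injective {n : ℕ} {d : Fin n → ℕ} (hd : Function.Injective d) :
    ∑ i ∈ range n, i ≤ ∑ i, d i := by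
  have hd' : Function.Injective fun i => (d i : ℤ) := Nat.cast_injective.comp hd
  have h := sum_range_le_sum (s := univ.image fun i => (d i : ℤ)) (c := 0) (by simp)
  simp only [card_image_of_injective _ hd', card_univ, Fintype.card_fin, zero_add,
    sum_image hd'.injOn] at h
  zify
  exact h

/-- The Vandermonde polynomial `∏_{i < j} (x_j - x_i)`. -/
noncomputable def vandermondePoly (n : ℕ) : MvPolynomial (Fin n) ℤ :=
  (Matrix.vandermonde X).det

theorem rename_vandermondePoly {n : ℕ} (e : Equiv.Perm (Fin n)) :
    rename e (vandermondePoly n) = (Equiv.Perm.sign e : ℤ) • vandermondePoly n := by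
  have h := Matrix.det_permute e (Matrix.vandermonde (X : Fin n → MvPolynomial (Fin n) ℤ))
  rw [vandermondePoly, zsmul_eq_mul, ← h, AlgHom.map_det]
  congr 1
  ext i j : 2
  simp [Matrix.vandermonde_apply]

theorem vandermondePoly_isHomogeneous (n : ℕ) :
    (vandermondePoly n).IsHomogeneous (∑ i ∈ range n, i) := by
  rw [vandermondePoly, Matrix.det_vandermonde]
  have h : ∑ i ∈ range n, i = ∑ i : Fin n, ∑ _j ∈ Ioi i, 1 := by
    simp only [sum_const, Fin.card_Ioi, smul_eq_mul, mul_one]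
    rw [← Finset.sum_range_reflect, Finset.sum_range]
  rw [h]
  exact IsHomogeneous.prod _ _ _ fun i _ => IsHomogeneous.prod _ _ _ fun j _ =>
    (isHomogeneous_X _ _).sub (isHomogeneous_X _ _)

/-- Symmetric operators preserve alternation, and distinct exponents sum to at least `0 + ⋯ + (n -
1)`; lowering the degree by `k ≥ 1` leaves no admissible monomial. -/
theorem diffOp_esymm_vandermondePoly {n k : ℕ} (hk : 1 ≤ k) :
    diffOp (Fin n) ℤ (esymm (Fin n) ℤ k) (vandermondePoly n) = 0 := by
  ext d
  rw [coeff_zero]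
  by_contra hd
  have h1 := degree_of_coeff_diffOp_esymm k (vandermondePoly_isHomogeneous n) hd
  have h2 := sum_range_le_sum_of_injective (injective_of_coeff_ne_zero (fun e => by
    rw [rename_diffOp, rename_esymm, rename_vandermondePoly, map_zsmul]) hd)
  rw [Finsupp.degree_eq_sum] at h1
  omega

theorem diffOp_vandermondePoly_of_mem_J {n : ℕ} {p : MvPolynomial (Fin n) ℤ} (hp : p ∈ J n) :
    diffOp (Fin n) ℤ p (vandermondePoly n) = 0 := by
  induction hp using Submodule.span_induction with
  | mem p hp =>
    obtain ⟨i, hi, -, rfl⟩ := hp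
    exact diffOp_esymm_vandermondePoly hi
  | zero => simp
  | add p q _ _ hp hq => simp [hp, hq]
  | smul a p _ hp => rw [smul_eq_mul, map_mul, Module.End.mul_apply, hp, map_zero]

end Vandermonde

/-! ### Iterated Leibniz rules. -/

section IteratedDerivation

variable {R A ι : Type*} [CommRing R] [CommRing A] [Algebra R A] (D : Derivation R A A)

theorem iterate_derivation_mul_of_eq_zero {g : A} (hg : D g = 0) (h : A) (k : ℕ) :
    D^[k] (g * h) = g * D^[k] h := by
  induction k with
  | zero => rfl
  | succ k ih => simp [Function.iterate_succ_apply', ih, hg]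

theorem iterate_derivation_linear_mul {l : A} (hl : D (D l) = 0) (h : A) (k : ℕ) :
    D^[k + 1] (l * h) = l * D^[k + 1] h + (k + 1) * D l * D^[k] h := by
  induction k with
  | zero => simp; ring
  | succ k ih =>
    rw [Function.iterate_succ_apply', ih]
    simp only [map_add, Derivation.leibniz, hl, smul_eq_mul, Function.iterate_succ_apply',
      Derivation.map_natCast, Derivation.map_one_eq_zero, mul_zero]
    push_cast
    ring

/-- Only terms differentiating each factor exactly once survive; the factorial counts the orders. -/
theorem iterate_derivation_prod {l : ι → A} (hl : ∀ i, D (D (l i)) = 0) (s : Finset ι) :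
    D^[#s] (∏ i ∈ s, l i) = (#s).factorial * ∏ i ∈ s, D (l i) := by
  classical
  induction s using Finset.induction_on with
  | empty => simp
  | insert i s hi ih =>
    have h0 : D (∏ i ∈ s, D (l i)) = 0 := by
      clear ih hi
      induction s using Finset.induction_on with
      | empty => simp
      | insert j s hj ih => simp [prod_insert hj, ih, hl]
    rw [prod_insert hi, card_insert_of_notMem hi, iterate_derivation_linear_mul D (hl i),
      Function.iterate_succ_apply', ih, prod_insert hi, Nat.factorial_succ]
    simp [h0]
    ring

end IteratedDerivation


/-! ### Powers of linear forms and separated pairs. -/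

section LinearForms

variable {n : ℕ} (a : Fin n → ℤ)

/-- The pairs `i < j` on which the coefficient vector `a` takes distinct values. -/
def separatedPairs : Finset (Fin n × Fin n) :=
  {p | p.1 < p.2 ∧ a p.1 ≠ a p.2}

/-- The derivative in direction `a`. -/
noncomputable def dirDeriv : Derivation ℤ (MvPolynomial (Fin n) ℤ) (MvPolynomial (Fin n) ℤ) :=
  mkDerivation ℤ fun i => C (a i)

theorem diffOp_linearForm (h : MvPolynomial (Fin n) ℤ) :
    diffOp (Fin n) ℤ (∑ i, a i • X i) h = dirDeriv a h := by
  have hsum (q : MvPolynomial (Fin n) ℤ) :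
      (∑ i, a i • pderiv i : Derivation ℤ _ (MvPolynomial (Fin n) ℤ)) q =
        ∑ i, a i • pderiv i q := by
    have := congrFun (map_sum (Derivation.coeFnAddMonoidHom (R := ℤ) (A := MvPolynomial (Fin n) ℤ)
      (M := MvPolynomial (Fin n) ℤ)) (fun i => a i • pderiv i) univ) q
    rw [Finset.sum_apply] at this
    exact this
  have hD : dirDeriv a = ∑ i, a i • pderiv i := by
    refine MvPolynomial.derivation_ext fun j => ?_
    rw [dirDeriv, mkDerivation_X, hsum]
    simp [pderiv_X, Pi.single_apply, smul_eq_C_mul]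
  rw [hD, hsum, map_sum, LinearMap.sum_apply]
  exact sum_congr rfl fun i _ => by simp

theorem diffOp_linearForm_pow (k : ℕ) (h : MvPolynomial (Fin n) ℤ) :
    diffOp (Fin n) ℤ ((∑ i, a i • X i) ^ k) h = (dirDeriv a)^[k] h := by
  induction k with
  | zero => simp
  | succ k ih =>
    rw [pow_succ', map_mul, Module.End.mul_apply, ih, diffOp_linearForm,
      Function.iterate_succ_apply']

theorem vandermondePoly_eq_prod (n : ℕ) :
    vandermondePoly n = ∏ p : Fin n × Fin n with p.1 < p.2, (X p.2 - X p.1) := by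
  rw [vandermondePoly, Matrix.det_vandermonde, prod_filter, Fintype.prod_prod_type]
  refine prod_congr rfl fun i _ => ?_
  rw [← prod_filter, filter_lt_eq_Ioi]

/-- Factors with `aᵢ = aⱼ` are constants for the derivation and pull out; each remaining factor is
differentiated once. -/
theorem iterate_dirDeriv_vandermondePoly_ne_zero :
    (dirDeriv a)^[#(separatedPairs a)] (vandermondePoly n) ≠ 0 := by
  have hX (p : Fin n × Fin n) : dirDeriv a (X p.2 - X p.1) = C (a p.2 - a p.1) := by
    simp [dirDeriv, mkDerivation_X]
  have hXX (p : Fin n × Fin n) : dirDeriv a (dirDeriv a (X p.2 - X p.1)) = 0 := by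
    rw [hX, ← algebraMap_eq, Derivation.map_algebraMap]
  have hsep : separatedPairs a =
      ({p | p.1 < p.2} : Finset (Fin n × Fin n)).filter fun p => a p.1 ≠ a p.2 := by
    rw [filter_filter]; rfl
  have hker : dirDeriv a (∏ p ∈ ({p | p.1 < p.2} : Finset (Fin n × Fin n)).filter
      fun p => ¬ a p.1 ≠ a p.2, (X p.2 - X p.1)) = 0 := by
    refine prod_induction _ (fun q => dirDeriv a q = 0) (fun p q hp hq => ?_) (by simp)
      fun p hp => ?_
    · simp [hp, hq]
    · rw [hX, not_not.1 (mem_filter.1 hp).2, sub_self, C_0]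
  rw [vandermondePoly_eq_prod, ← prod_filter_not_mul_prod_filter _ (fun p => a p.1 ≠ a p.2),
    iterate_derivation_mul_of_eq_zero _ hker, ← hsep, iterate_derivation_prod _ hXX]
  refine mul_ne_zero (prod_ne_zero_iff.2 fun p hp => ?_)
    (mul_ne_zero (Nat.cast_ne_zero.2 (Nat.factorial_ne_zero _)) (prod_ne_zero_iff.2 fun p hp => ?_))
  · rw [sub_ne_zero]
    exact fun h => (mem_filter.1 (mem_filter.1 hp).1).2.ne' (X_injective h)
  · rw [hX, Ne, C_eq_zero, sub_eq_zero]
    exact fun h => (mem_filter.1 hp).2.2 h.symm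

theorem sum_smul_x_eq_mk :
    ∑ i, a i • x i = Ideal.Quotient.mk (J n) (∑ i, a i • X i) := by
  simp [x]

theorem linearForm_pow_ne_zero {k : ℕ} (hk : k ≤ #(separatedPairs a)) :
    (∑ i, a i • x i) ^ k ≠ 0 := by
  rw [sum_smul_x_eq_mk, ← map_pow, Ne, Ideal.Quotient.eq_zero_iff_mem]
  intro hJ
  have h := diffOp_vandermondePoly_of_mem_J hJ
  rw [diffOp_linearForm_pow] at h
  apply iterate_dirDeriv_vandermondePoly_ne_zero a
  rw [← Nat.sub_add_cancel hk, Function.iterate_add_apply, h, iterate_map_zero]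

theorem two_mul_card_separatedPairs :
    2 * #(separatedPairs a) = ∑ i, #{j | a i ≠ a j} := by
  have hsep : #(separatedPairs a) = ∑ i, ∑ j, if i < j ∧ a i ≠ a j then 1 else 0 := by
    rw [separatedPairs, card_filter, Fintype.sum_prod_type]
  have hsplit (i j : Fin n) : (if a i ≠ a j then 1 else 0) =
      (if i < j ∧ a i ≠ a j then 1 else 0) + if j < i ∧ a j ≠ a i then 1 else 0 := by
    rcases lt_trichotomy i j with h | rfl | h
    · simp [h, h.not_gt]
    · simp
    · simp [h, h.not_gt, ne_comm]
  simp_rw [card_filter, hsplit, sum_add_distrib]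
  rw [sum_comm (f := fun i j => if j < i ∧ a j ≠ a i then 1 else 0), ← hsep, two_mul]

theorem le_card_separatedPairs (h : ∀ i, ∃ j k, j ≠ k ∧ a i ≠ a j ∧ a i ≠ a k) :
    n ≤ #(separatedPairs a) := by
  have h2 : ∑ _i : Fin n, 2 ≤ ∑ i, #{j | a i ≠ a j} := by
    refine sum_le_sum fun i _ => ?_
    obtain ⟨j, k, hjk, hj, hk⟩ := h i
    rw [← card_pair hjk]
    exact card_le_card fun l hl => by
      rcases mem_insert.1 hl with rfl | hl
      · simpa using hj
      · simpa [mem_singleton.1 hl] using hk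
  rw [← two_mul_card_separatedPairs, sum_const, card_univ, Fintype.card_fin, smul_eq_mul] at h2
  omega

/-- In the double count, row `i` contributes at least `n - 1` and every other row at least `1`. -/
theorem pred_le_card_separatedPairs {i : Fin n} (h : ∀ j, j ≠ i → a j ≠ a i) :
    n - 1 ≤ #(separatedPairs a) := by
  have hi : #{j | a i ≠ a j} ≥ n - 1 := by
    have : univ.erase i ⊆ ({j | a i ≠ a j} : Finset (Fin n)) := fun j hj => by
      simpa using (h j (ne_of_mem_erase hj)).symm
    simpa [card_erase_of_mem] using card_le_card this
  have hj : ∑ _j ∈ univ.erase i, 1 ≤ ∑ j ∈ univ.erase i, #{k | a j ≠ a k} :=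
    sum_le_sum fun j hj => card_pos.2 ⟨i, by simpa using h j (ne_of_mem_erase hj)⟩
  have htot := two_mul_card_separatedPairs a
  rw [← add_sum_erase _ _ (mem_univ i)] at htot
  simp only [sum_const, smul_eq_mul, mul_one, card_erase_of_mem (mem_univ i), card_univ,
    Fintype.card_fin] at hj
  omega

end LinearForms

/-! ### Relations in the quotient ring. -/

section Quotient

variable {n : ℕ}

theorem mk_esymm {k : ℕ} (hk : 1 ≤ k) (hkn : k ≤ n) :
    Ideal.Quotient.mk (J n) (esymm (Fin n) ℤ k) = 0 :=
  Ideal.Quotient.eq_zero_iff_mem.2 (Ideal.subset_span ⟨k, hk, hkn, rfl⟩)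

theorem sum_x_eq_zero : ∑ i, x i = (0 : CohomologyRing n) := by
  rcases Nat.eq_zero_or_pos n with rfl | hn
  · simp
  · simpa [esymm_one, x] using mk_esymm le_rfl hn

/-- Modulo `J n`, `∏ⱼ (T - xⱼ)` collapses to `T ^ n`; evaluate at `T = xᵢ`. -/
theorem x_pow_eq_zero (i : Fin n) : x i ^ n = 0 := by
  have h := Multiset.prod_X_sub_X_eq_sum_esymm (univ.val.map (x : Fin n → CohomologyRing n))
  have hes (k : ℕ) : (univ.val.map (x : Fin n → CohomologyRing n)).esymm k =
      Ideal.Quotient.mk (J n) (esymm (Fin n) ℤ k) := by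
    rw [esymm, esymm_map_val]
    simp only [map_sum, map_prod]
    rfl
  have h0 := congrArg (Polynomial.eval (x i)) h
  rw [Multiset.map_map, Polynomial.eval_multiset_prod, Multiset.map_map,
    Multiset.prod_eq_zero (Multiset.mem_map.2 ⟨i, mem_univ i, by simp⟩),
    Polynomial.eval_finsetSum, sum_range_succ'] at h0
  rw [sum_eq_zero, zero_add] at h0
  · simpa [Multiset.esymm] using h0.symm
  · intro k hk
    have hk' : k < n := by simpa using hk
    rw [hes, mk_esymm (by omega) hk', map_zero, zero_mul, mul_zero, Polynomial.eval_zero]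

theorem exists_eq_sum_of_mem_degreePart_one {f : CohomologyRing n} (hf : f ∈ degreePart n 1) :
    ∃ a : Fin n → ℤ, f = ∑ i, a i • x i := by
  rw [degreePart, homogeneousSubmodule_one_eq_span_X, Submodule.map_span, ← Set.range_comp] at hf
  obtain ⟨a, rfl⟩ := (Submodule.mem_span_range_iff_exists_fun ℤ).1 hf
  exact ⟨a, rfl⟩

theorem isNilpotent_linearForm (a : Fin n → ℤ) : IsNilpotent (∑ i, a i • x i) :=
  isNilpotent_sum fun i _ => IsNilpotent.smul ⟨n, x_pow_eq_zero i⟩ (a i)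

theorem sum_eq_smul_x {a : Fin n → ℤ} {i : Fin n} {b : ℤ} (h : ∀ j, j ≠ i → a j = b) :
    -- Subtracting `b • ∑ xⱼ = 0` clears every coefficient except that of `xᵢ`.
    ∑ j, a j • x j = (a i - b) • x i := by
  have hb : ∑ j, a j • x j = ∑ j, (a j - b) • x j := by
    simp_rw [sub_smul, sum_sub_distrib, ← smul_sum, sum_x_eq_zero, smul_zero, sub_zero]
  rw [hb]
  exact sum_eq_single i (fun j _ hj => by rw [h j hj, sub_self, zero_smul]) (by simp)

theorem exists_eq_off_or_separated (a : Fin n → ℤ) :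
    (∃ (i : Fin n) (b : ℤ), ∀ j, j ≠ i → a j = b) ∨
      ∀ i, ∃ j k, j ≠ k ∧ a i ≠ a j ∧ a i ≠ a k := by
  by_contra! h
  obtain ⟨h1, i, h2⟩ := h
  -- If `a` is not constant off `i`, some `j` has `aⱼ ≠ aᵢ`; as `a` is not equal to `aᵢ` everywhere
  -- off `j` either, a second such index `k` exists.
  obtain ⟨j, hj, hja⟩ := h1 i (a i)
  obtain ⟨k, hk, hka⟩ := h1 j (a i)
  exact hka (h2 j k hk.symm hja.symm).symm

end Quotient

end FlagCohomology

open FlagCohomology in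
theorem theorem4p1 (n : ℕ) (f : FlagCohomology.CohomologyRing n)
    (hf : f ∈ FlagCohomology.degreePart n 1) (hf0 : f ≠ 0) :
    IsNilpotent f ∧ n ≤ nilpotencyClass f ∧
      (nilpotencyClass f = n ↔ ∃ (i : Fin n) (c : ℤ), f = c • FlagCohomology.x i) := by
  obtain ⟨a, rfl⟩ := exists_eq_sum_of_mem_degreePart_one hf
  have hnil := isNilpotent_linearForm a
  have hlt {k : ℕ} (hk : k ≤ (separatedPairs a).card) : k < nilpotencyClass (∑ i, a i • x i) := by
    by_contra! hle
    exact linearForm_pow_ne_zero a hk (pow_eq_zero_of_le hle (pow_nilpotencyClass hnil))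
  rcases exists_eq_off_or_separated a with ⟨i, b, hb⟩ | hsep
  · have hx := sum_eq_smul_x hb
    have hab : a i ≠ b := fun h => hf0 (by rw [hx, h, sub_self, zero_smul])
    have hle : n ≤ nilpotencyClass (∑ i, a i • x i) := by
      have := hlt (pred_le_card_separatedPairs a (i := i) fun j hj => by rw [hb j hj]; exact hab.symm)
      omega
    refine ⟨hnil, hle, fun _ => ⟨i, _, hx⟩, fun _ => le_antisymm (Nat.sInf_le ?_) hle⟩
    change (∑ i, a i • x i) ^ n = 0
    rw [hx, smul_pow, x_pow_eq_zero, smul_zero]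
  · have hn := hlt (le_card_separatedPairs a hsep)
    refine ⟨hnil, hn.le, fun h => absurd h hn.ne', ?_⟩
    -- A multiple of `xᵢ` has zero `n`-th power, contradicting order greater than `n`.
    rintro ⟨i, c, hc⟩
    refine absurd (Nat.sInf_le ?_) hn.not_ge
    change (∑ i, a i • x i) ^ n = 0
    rw [hc, smul_pow, x_pow_eq_zero, smul_zero]
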